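/- **Conventions.** A *Feldman–Moore relation* $(X,\mu,R,\sigma)$ consists of a standard Borel probability space $(X,\mu)$, a Borel equivalence relation $R\subseteq X\times X$ with countable classes under which $\mu$ is quasi-invariant (for Borel $\alpha\subseteq X$, $\mu(\alpha)=0$ iff the $R$-saturation of $\alpha$ is $\mu$-null), and a Borel map $\sigma\colon\{(x,y,z): x\sim y\sim z\}\to\mathbb T$ with $\sigma(x,y,z)\sigma(x,z,w)=\sigma(x,y,w)\sigma(y,z,w)$ whenever $x\sim y\sim z\sim w$, and $\sigma(x,y,z)=1$ whenever two of $x,y,z$ are equal. Its right counting measure is $\nu(E)=\int_X|\{x:(x,y)\in E\}|\,d\mu(y)$. A bounded Borel function $a\colon R\to\mathbb C$ is *left finite* if the numbers of points in the horizontal and in the vertical slices of its support are uniformly bounded; then $L_0(a)\xi(x,z)=\sum_{y\sim x}a(x,y)\xi(y,z)\sigma(x,y,z)$ is a bounded operator on $H=L^2(R,\nu)$. Let $\mathcal M(R,\sigma)\subseteq\mathcal B(H)$ be the von Neumann algebra generated by the operators $L_0(a)$, $a$ left finite. With $\chi_\Delta\in H$ the characteristic function of the diagonal, put $s(T)=T\chi_\Delta$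 for $T\in\mathcal M(R,\sigma)$; $s$ is injective, and its range $\Sigma(R,\sigma)$ is the *symbol set*. The *Schur multiplier algebra* is $$\mathfrak S(R,\sigma)=\{\varphi\in L^\infty(R,\nu):\ \varphi a\in\Sigma(R,\sigma)\text{ for all }a\in\Sigma(R,\sigma)\},$$ an algebra under pointwise operations, normed by $\|\cdot\|_\infty$. Each $\varphi\in\mathfrak S(R,\sigma)$ defines $M(\varphi)\colon\mathcal M(R,\sigma)\to\mathcal M(R,\sigma)$, $M(\varphi)(T)=s^{-1}(\varphi\, s(T))$. An *isomorphism* from $(X_1,\mu_1,R_1,\sigma_1)$ onto $(X_2,\mu_2,R_2,\sigma_2)$ is a Borel isomorphism $\rho\colon X_1\to X_2$ such that (i) $\rho_*\mu_1$ and $\mu_2$ are mutually absolutely continuous; (ii) $(\rho\times\rho)(R_1)=R_2$ up to a null set for the counting measure $E\mapsto\int|\{x:(x,y)\in E\}|\,d\mu_2(y)$; (iii) $\sigma_2(\rho(x),\rho(y),\rho(z))=\sigma_1(x,y,z)$ for almost every $(x,y,z)$ with $x\sim y\sim z$ in $R_1$, with respect to $E\mapsto\int|\{(x,y):(x,y,z)\in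 E\}|\,d\mu_1(z)$. **Proposition 4.11.** Let $\rho$ be an isomorphism from the Feldman–Moore relation $(X_1,\mu_1,R_1,\sigma_1)$ onto the Feldman–Moore relation $(X_2,\mu_2,R_2,\sigma_2)$, and let $\rho^{-2}(u,v)=(\rho^{-1}(u),\rho^{-1}(v))$. Then $\tilde\rho\colon a\mapsto a\circ\rho^{-2}$ is well defined on functions modulo null sets, it is a bijection from $\Sigma(R_1,\sigma_1)$ onto $\Sigma(R_2,\sigma_2)$, and it is an isometric algebra isomorphism from $\mathfrak S(R_1,\sigma_1)$ onto $\mathfrak S(R_2,\sigma_2)$: one has $\|\tilde\rho(\varphi)\|_\infty=\|\varphi\|_\infty$ and also $\|M(\tilde\rho(\varphi))\|=\|M(\varphi)\|$ for every $\varphi\in\mathfrak S(R_1,\sigma_1)$. -/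

import Mathlib

open MeasureTheory MeasureTheory.Measure Set
open scoped ENNReal

noncomputable section

/-- Complex functions modulo null sets form a commutative ring under pointwise operations; the
additive group and the multiplicative monoid are Mathlib's. -/
instance instCommRingAEEqFun {α : Type*} [MeasurableSpace α] {μ : Measure α} :
    CommRing (α →ₘ[μ] ℂ) where
  toAddCommGroup := AEEqFun.instAddCommGroup
  toMul := AEEqFun.instMul
  toOne := AEEqFun.instOne
  mul_assoc := mul_assoc
  one_mul := one_mul
  mul_one := mul_one
  mul_comm := mul_comm
  left_distrib a b c := by
    induction a, b, c using AEEqFun.induction_on₃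
    simp only [AEEqFun.mk_add_mk, AEEqFun.mk_mul_mk, mul_add]
  right_distrib a b c := by
    induction a, b, c using AEEqFun.induction_on₃
    simp only [AEEqFun.mk_add_mk, AEEqFun.mk_mul_mk, add_mul]
  zero_mul a := AEEqFun.toGerm_injective (by
    rw [AEEqFun.mul_toGerm, AEEqFun.zero_toGerm, zero_mul])
  mul_zero a := AEEqFun.toGerm_injective (by
    rw [AEEqFun.mul_toGerm, AEEqFun.zero_toGerm, mul_zero])
  npow n f := f ^ n
  npow_zero := pow_zero
  npow_succ n f := pow_succ f n

/-- The pointwise algebra structure; the scalar action is Mathlib's. -/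
instance instAlgebraAEEqFun {α : Type*} [MeasurableSpace α] {μ : Measure α} :
    Algebra ℂ (α →ₘ[μ] ℂ) :=
  Algebra.ofModule
    (fun c f g ↦ by
      induction f, g using AEEqFun.induction_on₂
      simp only [AEEqFun.smul_mk, AEEqFun.mk_mul_mk, smul_mul_assoc])
    (fun c f g ↦ by
      induction f, g using AEEqFun.induction_on₂
      simp only [AEEqFun.smul_mk, AEEqFun.mk_mul_mk, mul_smul_comm])

/-- A Feldman–Moore relation `(X, μ, R, σ)` on a standard Borel space `X`: a Borel probability
measure `μ`, a countable Borel equivalence relation `R ⊆ X × X` under which `μ` is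
quasi-invariant, and a normalised Borel `2`-cocycle `σ` with values in the unit circle.
The cocycle is a total function of three variables, but only its restriction to the composable
triples `x ∼ y ∼ z` is constrained or used. -/
structure FeldmanMooreRelation (X : Type*) [MeasurableSpace X] [StandardBorelSpace X] where
  /-- the probability measure on `X` -/
  μ : Measure X
  isProbabilityMeasure : IsProbabilityMeasure μ
  /-- the equivalence relation -/
  r : Setoid X
  measurableSet_rel : MeasurableSet {p : X × X | r p.1 p.2}
  countable_class : ∀ x, {y | r x y}.Countable
  quasiInvariant : ∀ α : Set X, MeasurableSet α → (μ α = 0 ↔ μ {y | ∃ x ∈ α, r x y} = 0)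
  /-- the cocycle -/
  σ : X → X → X → Circle
  measurable_σ :
    Measurable fun p : {p : X × X × X // r p.1 p.2.1 ∧ r p.2.1 p.2.2} ↦
      (σ p.1.1 p.1.2.1 p.1.2.2 : ℂ)
  cocycle : ∀ x y z w, r x y → r y z → r z w → σ x y z * σ x z w = σ x y w * σ y z w
  normalised : ∀ x y z, r x y → r y z → (x = y ∨ y = z ∨ x = z) → σ x y z = 1

namespace FeldmanMooreRelation

variable {X : Type*} [MeasurableSpace X] [StandardBorelSpace X]

instance (R : FeldmanMooreRelation X) : IsProbabilityMeasure R.μ := R.isProbabilityMeasure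

/-- The relation as a subset of `X × X`. -/
def graph (R : FeldmanMooreRelation X) : Set (X × X) := {p | R.r p.1 p.2}

/-- The counting measure of the horizontal slice of `R` at `y`, as a measure on `X × X`:
`E ↦ |{x | (x, y) ∈ E ∩ R}|`. -/
def sliceCount (R : FeldmanMooreRelation X) (y : X) : Measure (X × X) :=
  Measure.sum fun x : {x : X // R.r x y} ↦ Measure.dirac (x.1, y)

/-- The right counting measure `ν(E) = ∫ |E_y| dμ(y)`, extended from `R` to `X × X` by zero, so
that functions on `R` modulo `ν`-null sets are functions on `X × X` modulo `ν`-null sets. -/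
def ν (R : FeldmanMooreRelation X) : Measure (X × X) := R.μ.bind R.sliceCount

/-- The diagonal `Δ` of `R`. -/
def diag (X : Type*) : Set (X × X) := {p | p.1 = p.2}

theorem measurableSet_diag : MeasurableSet (diag X) :=
  measurableSet_eq_fun measurable_fst measurable_snd

theorem sliceCount_diag_le (R : FeldmanMooreRelation X) (y : X) :
    R.sliceCount y (diag X) ≤ 1 := by
  rw [sliceCount, Measure.sum_apply _ measurableSet_diag]
  rw [tsum_eq_single (⟨y, R.r.refl y⟩ : {x : X // R.r x y})]
  · rw [dirac_apply' _ measurableSet_diag]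
    exact indicator_le_self' (fun _ _ ↦ zero_le) _
  · rintro ⟨x, hx⟩ hne
    rw [dirac_apply' _ measurableSet_diag, indicator_of_notMem]
    intro h
    exact hne (Subtype.ext h)

theorem ν_diag_ne_top (R : FeldmanMooreRelation X) : R.ν (diag X) ≠ ∞ := by
  by_cases h : AEMeasurable R.sliceCount R.μ
  · rw [ν, bind_apply measurableSet_diag h]
    refine ne_top_of_le_ne_top ENNReal.one_ne_top ?_
    calc ∫⁻ y, R.sliceCount y (diag X) ∂(R.μ) ≤ ∫⁻ _, 1 ∂(R.μ) := lintegral_mono R.sliceCount_diag_le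
      _ = 1 := by simp
  · simp [ν, Measure.bind, Measure.map_of_not_aemeasurable h]

/-- The Hilbert space `H = L²(R, ν)`. -/
abbrev H (R : FeldmanMooreRelation X) : Type _ := Lp ℂ 2 R.ν

/-- The vector `χ_Δ ∈ H`. -/
def chiDiag (R : FeldmanMooreRelation X) : R.H :=
  indicatorConstLp 2 measurableSet_diag R.ν_diag_ne_top (1 : ℂ)

/-- `𝔹(E) = sup_{x, y} |E_x| + |E^y|`, the supremum of the sums of the cardinalities of a
horizontal and of a vertical slice of `E`. -/
def bandWidth (E : Set (X × X)) : ℕ∞ :=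
  ⨆ (x : X) (y : X), {z | (z, x) ∈ E}.encard + {z | (y, z) ∈ E}.encard

/-- Left finite functions: bounded Borel functions on `R` (extended by `0` to `X × X`) with band
limited support. This is the set `Σ₀`. -/
def IsLeftFinite (R : FeldmanMooreRelation X) (a : X × X → ℂ) : Prop :=
  Measurable a ∧ (∃ C : ℝ, ∀ p, ‖a p‖ ≤ C) ∧ Function.support a ⊆ R.graph ∧
    bandWidth (Function.support a) < ⊤

/-- The twisted convolution `(a *_σ ξ)(x, z) = ∑_{y ∼ x} a(x, y) ξ(y, z) σ(x, y, z)`. For left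
finite `a` the sum is finite, and the restriction `y ∼ x` is automatic as `a` vanishes off `R`. -/
def conv (R : FeldmanMooreRelation X) (a ξ : X × X → ℂ) (p : X × X) : ℂ :=
  ∑' y : X, a (p.1, y) * ξ (y, p.2) * (R.σ p.1 y p.2 : ℂ)

/-- `𝓜₀(R, σ)`: the bounded operators `L₀(a) : ξ ↦ a *_σ ξ` on `H`, for left finite `a`. -/
def leftFiniteOperators (R : FeldmanMooreRelation X) : Set (R.H →L[ℂ] R.H) :=
  {T | ∃ a, R.IsLeftFinite a ∧ ∀ ξ : R.H, T ξ =ᵐ[R.ν] R.conv a ξ}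

/-- The von Neumann algebra `𝓜(R, σ)` on `H` generated by `𝓜₀(R, σ)`: the double commutant of
`𝓜₀(R, σ)` (together with the adjoints of its elements). -/
def vonNeumannAlgebra (R : FeldmanMooreRelation X) : VonNeumannAlgebra R.H where
  toStarSubalgebra := StarSubalgebra.centralizer ℂ
    (StarSubalgebra.centralizer ℂ R.leftFiniteOperators : Set (R.H →L[ℂ] R.H))
  centralizer_centralizer' := by
    have key : ∀ S : StarSubalgebra ℂ (R.H →L[ℂ] R.H),
        ((StarSubalgebra.centralizer ℂ (S : Set (R.H →L[ℂ] R.H)) : StarSubalgebra ℂ _) :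
          Set (R.H →L[ℂ] R.H)) = Set.centralizer (S : Set (R.H →L[ℂ] R.H)) := by
      intro S
      rw [StarSubalgebra.coe_centralizer, StarMemClass.star_coe_eq, Set.union_self]
    change Set.centralizer (Set.centralizer ((StarSubalgebra.centralizer ℂ
      (StarSubalgebra.centralizer ℂ R.leftFiniteOperators : Set (R.H →L[ℂ] R.H)) :
        StarSubalgebra ℂ _) : Set (R.H →L[ℂ] R.H))) = ((StarSubalgebra.centralizer ℂ
      (StarSubalgebra.centralizer ℂ R.leftFiniteOperators : Set (R.H →L[ℂ] R.H)) :
        StarSubalgebra ℂ _) : Set (R.H →L[ℂ] R.H))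
    rw [key, Set.centralizer_centralizer_centralizer]

theorem leftFiniteOperators_subset (R : FeldmanMooreRelation X) :
    R.leftFiniteOperators ⊆ (R.vonNeumannAlgebra : Set (R.H →L[ℂ] R.H)) := by
  intro T hT
  refine (StarSubalgebra.mem_centralizer_iff ℂ).2 fun g hg ↦ ⟨?_, ?_⟩
  · exact (((StarSubalgebra.mem_centralizer_iff ℂ).1 hg) T hT).1.symm
  · exact (((StarSubalgebra.mem_centralizer_iff ℂ).1 (star_mem hg)) T hT).1.symm

/-- The symbol map `s(T) = T χ_Δ`, as a function on `R` modulo `ν`-null sets. -/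
def symbol (R : FeldmanMooreRelation X) (T : R.H →L[ℂ] R.H) : X × X →ₘ[R.ν] ℂ :=
  (T R.chiDiag : X × X →ₘ[R.ν] ℂ)

/-- The symbol set `Σ(R, σ) = s(𝓜(R, σ))`. -/
def symbolSet (R : FeldmanMooreRelation X) : Set (X × X →ₘ[R.ν] ℂ) :=
  R.symbol '' (R.vonNeumannAlgebra : Set (R.H →L[ℂ] R.H))

/-- `φ ∈ L^∞(R, ν)` is a Schur multiplier if `φ ⋆ a ∈ Σ(R, σ)` for all `a ∈ Σ(R, σ)`, where `⋆`
is the pointwise product. -/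
def IsSchurMultiplier (R : FeldmanMooreRelation X) (φ : X × X →ₘ[R.ν] ℂ) : Prop :=
  φ ∈ Lp ℂ ∞ R.ν ∧ ∀ a ∈ R.symbolSet, φ * a ∈ R.symbolSet

theorem symbolSet_add {R : FeldmanMooreRelation X} {a b : X × X →ₘ[R.ν] ℂ}
    (ha : a ∈ R.symbolSet) (hb : b ∈ R.symbolSet) : a + b ∈ R.symbolSet := by
  obtain ⟨S, hS, rfl⟩ := ha
  obtain ⟨T, hT, rfl⟩ := hb
  exact ⟨S + T, add_mem (S := VonNeumannAlgebra R.H) hS hT, rfl⟩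

theorem symbolSet_smul {R : FeldmanMooreRelation X} (c : ℂ) {a : X × X →ₘ[R.ν] ℂ}
    (ha : a ∈ R.symbolSet) : c • a ∈ R.symbolSet := by
  obtain ⟨S, hS, rfl⟩ := ha
  exact ⟨c • S, R.vonNeumannAlgebra.toStarSubalgebra.smul_mem hS c, rfl⟩

/-- The algebra `𝔖(R, σ)` of Schur multipliers, under pointwise operations. -/
def schurMultipliers (R : FeldmanMooreRelation X) : Subalgebra ℂ (X × X →ₘ[R.ν] ℂ) where
  carrier := {φ | R.IsSchurMultiplier φ}
  mul_mem' := by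
    rintro φ ψ ⟨hφ, hφ'⟩ ⟨hψ, hψ'⟩
    refine ⟨?_, fun a ha ↦ by rw [mul_assoc]; exact hφ' _ (hψ' a ha)⟩
    rw [Lp.mem_Lp_iff_memLp] at *
    exact (hφ.mul' hψ (r := ∞) |>.ae_eq (by
      filter_upwards [AEEqFun.coeFn_mul φ ψ] with p hp
      simp [hp, mul_comm]))
  add_mem' := by
    rintro φ ψ ⟨hφ, hφ'⟩ ⟨hψ, hψ'⟩
    exact ⟨add_mem hφ hψ, fun a ha ↦ by rw [add_mul]; exact symbolSet_add (hφ' a ha) (hψ' a ha)⟩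
  algebraMap_mem' := by
    intro c
    rw [Algebra.algebraMap_eq_smul_one]
    refine ⟨?_, fun a ha ↦ by rw [smul_one_mul]; exact symbolSet_smul c ha⟩
    rw [Lp.mem_Lp_iff_memLp]
    refine (memLp_top_const c).ae_eq ?_
    filter_upwards [AEEqFun.coeFn_smul c (1 : X × X →ₘ[R.ν] ℂ),
      AEEqFun.coeFn_one (α := X × X) (β := ℂ) (μ := R.ν)] with p hp h1
    simp [hp, h1]

/-- The norm `‖M(φ)‖` of the operator `M(φ) : 𝓜 → 𝓜`, `M(φ)(T) = s⁻¹(φ ⋆ s(T))`, i.e. the supremum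
of `‖M(φ)(T)‖` over `T` in the unit ball of `𝓜`. The condition on `S` says `S = M(φ)(T)`. -/
def multiplierNorm (R : FeldmanMooreRelation X) (φ : X × X →ₘ[R.ν] ℂ) : ℝ≥0∞ :=
  ⨆ (T ∈ R.vonNeumannAlgebra) (_ : ‖T‖ ≤ 1) (S ∈ R.vonNeumannAlgebra)
    (_ : R.symbol S = φ * R.symbol T), ‖S‖ₑ

/-- `ρ : X₁ → X₂` is an isomorphism of Feldman–Moore relations. Null sets for the counting
measures `E ↦ ∫ |E_y| dμ(y)` are those with empty slice `E_y` for `μ`-almost every last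
coordinate `y`, and conditions `rel` and `cocycle` spell this out. -/
structure IsIsomorphism {X₁ X₂ : Type*} [MeasurableSpace X₁] [StandardBorelSpace X₁]
    [MeasurableSpace X₂] [StandardBorelSpace X₂] (R₁ : FeldmanMooreRelation X₁)
    (R₂ : FeldmanMooreRelation X₂) (ρ : X₁ ≃ᵐ X₂) : Prop where
  /-- `ρ_* μ₁` and `μ₂` are equivalent measures -/
  map_absolutelyContinuous : R₁.μ.map ρ ≪ R₂.μ
  absolutelyContinuous_map : R₂.μ ≪ R₁.μ.map ρ
  /-- `(ρ × ρ)(R₁) = R₂` up to a `ν₂`-null set -/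
  rel : ∀ᵐ y ∂(R₂.μ), {x | (x, y) ∈ symmDiff (Prod.map ρ ρ '' R₁.graph) R₂.graph} = ∅
  /-- `σ₂(ρ(x), ρ(y), ρ(z)) = σ₁(x, y, z)` for almost every `(x, y, z)` with `x ∼ y ∼ z`,
  with respect to `E ↦ ∫ |{(x, y) | (x, y, z) ∈ E}| dμ₁(z)` -/
  cocycle : ∀ᵐ z ∂(R₁.μ), {p : X₁ × X₁ | R₁.r p.1 p.2 ∧ R₁.r p.2 z ∧
    R₂.σ (ρ p.1) (ρ p.2) (ρ z) ≠ R₁.σ p.1 p.2 z} = ∅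

end FeldmanMooreRelation

end

/-! Let `h` be the density of `ρ_* μ₁` with respect to `μ₂`, chosen positive and finite everywhere.
Since `ρ` matches classes over almost every last coordinate, `(ρ × ρ)_* ν₁` has density `h z` with
respect to `ν₂`, so `U ξ (x, z) = √(h z) ξ (ρ⁻¹ x, ρ⁻¹ z)` is unitary (`exists_implements`). The
weight depends only on the last coordinate, which twisted convolution does not touch. Hence `U L₀(a)
U⁻¹` is `L₀` of the transported `a`, and conjugation by `U` maps `𝓜(R₁, σ₁)` isometrically into
`𝓜(R₂, σ₂)`.

The obstacle is that `U⁻¹ χ_Δ` is not `χ_Δ` but `d χ_Δ` with a possibly unbounded `d` of the last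
coordinate. Bounded functions of the last coordinate give operators in the commutant, so truncation
yields `T (d χ_Δ) = d s(T)` (`apply_mulSnd_chiDiag`). The weight of `U` then cancels `d`, leaving
`s(U T U⁻¹) = s(T) ∘ ρ⁻²` (`symbol_conj`).

The rest is formal: composition is multiplicative and does not increase the essential supremum, and
the same applies to `ρ⁻¹`, so inclusions become bijections and inequalities become equalities. -/

open Filter
open scoped NNReal

namespace FeldmanMooreRelation

/-! ### Null sets of the counting measure, slice by slice -/

section Slices

variable {X : Type*} [MeasurableSpace X] [StandardBorelSpace X] (R : FeldmanMooreRelation X)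

theorem sliceCount_apply_eq_zero_iff {E : Set (X × X)} (hE : MeasurableSet E) (y : X) :
    R.sliceCount y E = 0 ↔ ∀ x, R.r x y → (x, y) ∉ E := by
  rw [sliceCount, Measure.sum_apply _ hE, ENNReal.tsum_eq_zero]
  refine ⟨fun h x hx hxE ↦ ?_, fun h x ↦ ?_⟩
  · have := h ⟨x, hx⟩
    rw [dirac_apply' _ hE] at this
    simp [hxE] at this
  · rw [dirac_apply' _ hE]
    simp [h x.1 x.2]

/-- A property that holds on almost every horizontal slice of `R` holds `ν`-almost everywhere. -/
theorem ae_ν_of_ae_slice {P : X × X → Prop}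
    (h : ∀ᵐ z ∂(R.μ), ∀ x, R.r x z → P (x, z)) : ∀ᵐ p ∂(R.ν), P p := by
  obtain ⟨N, hN, hNm, hN0⟩ := exists_measurable_superset_of_null (ae_iff.1 h)
  have hE : MeasurableSet (R.graphᶜ ∪ Prod.snd ⁻¹' N) :=
    R.measurableSet_rel.compl.union (measurable_snd hNm)
  have hE0 : R.ν (R.graphᶜ ∪ Prod.snd ⁻¹' N) = 0 := by
    -- The upper bound for `bind` requires no measurability of `sliceCount`.
    refine le_antisymm ((bind_apply_le _ hE).trans ?_) zero_le
    rw [nonpos_iff_eq_zero]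
    refine lintegral_eq_zero_of_ae_eq_zero ?_
    have : ∀ᵐ z ∂(R.μ), z ∉ N := measure_eq_zero_iff_ae_notMem.1 hN0
    filter_upwards [this] with z hz
    refine (R.sliceCount_apply_eq_zero_iff hE z).2 fun x hx hxE ↦ ?_
    rcases hxE with hxE | hxE
    · exact hxE hx
    · exact hz hxE
  filter_upwards [measure_eq_zero_iff_ae_notMem.1 hE0] with p hp
  simp only [mem_union, not_or, mem_compl_iff, not_not, mem_preimage] at hp
  by_contra hP
  exact hp.2 (hN fun hz ↦ hP (hz p.1 hp.1))

theorem ae_ν_of_ae_snd {Q : X → Prop} (h : ∀ᵐ z ∂(R.μ), Q z) : ∀ᵐ p ∂(R.ν), Q p.2 :=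
  R.ae_ν_of_ae_slice (by filter_upwards [h] with z hz x _ using hz)

theorem ae_ν_mem_graph : ∀ᵐ p ∂(R.ν), R.r p.1 p.2 :=
  R.ae_ν_of_ae_slice (Eventually.of_forall fun _ _ h ↦ h)

/-- `bind` takes the default value `0` on a kernel that is not a.e. measurable. Arguments that need
measurability of `sliceCount` therefore split into cases, the second being trivial. -/
theorem ν_eq_zero_of_not_aemeasurable (h : ¬ AEMeasurable R.sliceCount R.μ) : R.ν = 0 := by
  simp [ν, Measure.bind, Measure.map_of_not_aemeasurable h]

/-- A property that holds `ν`-almost everywhere holds on the whole horizontal slice through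
almost every point. -/
theorem ae_ν_forall_slice {P : X × X → Prop} (h : ∀ᵐ p ∂(R.ν), P p) :
    ∀ᵐ p ∂(R.ν), ∀ y, R.r y p.2 → P (y, p.2) := by
  by_cases hm : AEMeasurable R.sliceCount R.μ
  · obtain ⟨N, hN, hNm, hN0⟩ := exists_measurable_superset_of_null (ae_iff.1 h)
    rw [ν, bind_apply hNm hm, lintegral_eq_zero_iff' (by
      exact (measurable_coe hNm).comp_aemeasurable hm)] at hN0
    refine R.ae_ν_of_ae_snd (Q := fun z ↦ ∀ y, R.r y z → P (y, z)) ?_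
    filter_upwards [hN0] with z hz x hx
    by_contra hP
    exact (R.sliceCount_apply_eq_zero_iff hNm z).1 hz x hx (hN hP)
  · rw [R.ν_eq_zero_of_not_aemeasurable hm]
    simp

theorem chiDiag_coeFn : (R.chiDiag : X × X → ℂ) =ᵐ[R.ν] (diag X).indicator fun _ ↦ 1 :=
  indicatorConstLp_coeFn

end Slices

/-! ### Isomorphisms and the change of measure -/

namespace IsIsomorphism

variable {X₁ X₂ : Type*} [MeasurableSpace X₁] [StandardBorelSpace X₁]
  [MeasurableSpace X₂] [StandardBorelSpace X₂]
  {R₁ : FeldmanMooreRelation X₁} {R₂ : FeldmanMooreRelation X₂} {ρ : X₁ ≃ᵐ X₂}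

theorem quasiMeasurePreserving (hρ : IsIsomorphism R₁ R₂ ρ) :
    QuasiMeasurePreserving ρ R₁.μ R₂.μ :=
  ⟨ρ.measurable, hρ.map_absolutelyContinuous⟩

theorem quasiMeasurePreserving_symm (hρ : IsIsomorphism R₁ R₂ ρ) :
    QuasiMeasurePreserving ρ.symm R₂.μ R₁.μ := by
  refine ⟨ρ.symm.measurable, ?_⟩
  have := hρ.absolutelyContinuous_map.map ρ.symm.measurable
  rwa [MeasurableEquiv.map_symm_map] at this

/-- Over almost every last coordinate, the isomorphism respects the relations. -/
theorem ae_rel_iff (hρ : IsIsomorphism R₁ R₂ ρ) :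
    ∀ᵐ z ∂(R₁.μ), ∀ x, R₁.r x z ↔ R₂.r (ρ x) (ρ z) := by
  filter_upwards [hρ.quasiMeasurePreserving.ae hρ.rel] with z hz x
  have h : (ρ x, ρ z) ∉ symmDiff (Prod.map ρ ρ '' R₁.graph) R₂.graph := fun h ↦
    (eq_empty_iff_forall_notMem.1 hz) (ρ x) h
  rw [mem_symmDiff] at h
  have h1 : (ρ x, ρ z) ∈ Prod.map ρ ρ '' R₁.graph ↔ R₁.r x z := by
    constructor
    · rintro ⟨⟨a, b⟩, hab, he⟩
      simp only [Prod.map_apply, Prod.mk.injEq, EmbeddingLike.apply_eq_iff_eq] at he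
      rw [← he.1, ← he.2]
      exact hab
    · exact fun h ↦ ⟨(x, z), h, rfl⟩
  have h2 : (ρ x, ρ z) ∈ R₂.graph ↔ R₂.r (ρ x) (ρ z) := Iff.rfl
  rw [h1, h2] at h
  tauto

theorem ae_cocycle_eq (hρ : IsIsomorphism R₁ R₂ ρ) :
    ∀ᵐ z ∂(R₁.μ), ∀ x y, R₁.r x y → R₁.r y z → R₂.σ (ρ x) (ρ y) (ρ z) = R₁.σ x y z := by
  filter_upwards [hρ.cocycle] with z hz x y hxy hyz
  by_contra h
  exact (eq_empty_iff_forall_notMem.1 hz) (x, y) ⟨hxy, hyz, h⟩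

theorem symm (hρ : IsIsomorphism R₁ R₂ ρ) : IsIsomorphism R₂ R₁ ρ.symm where
  map_absolutelyContinuous := hρ.quasiMeasurePreserving_symm.2
  absolutelyContinuous_map := by
    have := hρ.map_absolutelyContinuous.map ρ.symm.measurable
    rwa [MeasurableEquiv.map_symm_map] at this
  rel := by
    filter_upwards [hρ.ae_rel_iff] with z hz
    refine eq_empty_iff_forall_notMem.2 fun x hx ↦ ?_
    have h1 : (x, z) ∈ Prod.map ρ.symm ρ.symm '' R₂.graph ↔ R₂.r (ρ x) (ρ z) := by
      constructor
      · rintro ⟨⟨a, b⟩, hab, he⟩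
        simp only [Prod.map_apply, Prod.mk.injEq] at he
        rw [← he.1, ← he.2, ρ.apply_symm_apply, ρ.apply_symm_apply]
        exact hab
      · exact fun h ↦ ⟨(ρ x, ρ z), h, by simp⟩
    have h2 : (x, z) ∈ R₁.graph ↔ R₁.r x z := Iff.rfl
    rw [mem_ofPred_eq, mem_symmDiff, h1, h2, hz x] at hx
    tauto
  cocycle := by
    filter_upwards [hρ.quasiMeasurePreserving_symm.ae hρ.ae_rel_iff,
      hρ.quasiMeasurePreserving_symm.ae hρ.ae_cocycle_eq] with z hz hz'
    refine eq_empty_iff_forall_notMem.2 ?_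
    rintro ⟨x, y⟩ ⟨hxy, hyz, hne⟩
    simp only [ρ.apply_symm_apply] at hz hz'
    -- The relations can be compared only against the last coordinate `z`, so the relation between
    -- `ρ⁻¹ x` and `ρ⁻¹ y` is obtained through `ρ⁻¹ z`.
    have hy : R₁.r (ρ.symm y) (ρ.symm z) := by rw [hz, ρ.apply_symm_apply]; exact hyz
    have hx : R₁.r (ρ.symm x) (ρ.symm z) := by
      rw [hz, ρ.apply_symm_apply]; exact R₂.r.trans hxy hyz
    have := hz' (ρ.symm x) (ρ.symm y) (R₁.r.trans hx (R₁.r.symm hy)) hy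
    simp only [ρ.apply_symm_apply] at this
    exact hne this.symm

/-- For almost every `z`, `ρ` maps the class of `z` bijectively onto that of `ρ z`, so the two sums
of Dirac masses differ by a reindexing. -/
theorem ae_map_sliceCount (hρ : IsIsomorphism R₁ R₂ ρ) :
    ∀ᵐ z ∂(R₁.μ), (R₁.sliceCount z).map (Prod.map ρ ρ) = R₂.sliceCount (ρ z) := by
  have hm : Measurable (Prod.map ρ ρ) := ρ.measurable.prodMap ρ.measurable
  filter_upwards [hρ.ae_rel_iff] with z hz
  rw [sliceCount, sliceCount, Measure.map_sum hm.aemeasurable]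
  simp only [map_dirac' hm]
  let e : {x : X₁ // R₁.r x z} ≃ {x : X₂ // R₂.r x (ρ z)} := ρ.toEquiv.subtypeEquiv hz
  ext s hs
  rw [Measure.sum_apply _ hs, Measure.sum_apply _ hs,
    ← e.tsum_eq fun x : {x : X₂ // R₂.r x (ρ z)} ↦ dirac (x.1, ρ z) s]
  rfl

/-- With the same statement for `ρ⁻¹`, this puts both relations on the same side of the
measurability dichotomy: `ν₁` and `ν₂` degenerate to `0` together. -/
theorem aemeasurable_sliceCount (hρ : IsIsomorphism R₁ R₂ ρ)
    (h : AEMeasurable R₁.sliceCount R₁.μ) : AEMeasurable R₂.sliceCount R₂.μ := by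
  have hm : Measurable (Prod.map ρ ρ) := ρ.measurable.prodMap ρ.measurable
  have h1 : AEMeasurable (fun z ↦ R₂.sliceCount (ρ z)) R₁.μ :=
    ((measurable_map _ hm).comp_aemeasurable h).congr hρ.ae_map_sliceCount
  have h2 := h1.comp_quasiMeasurePreserving hρ.quasiMeasurePreserving_symm
  simpa [Function.comp_def] using h2

/-- If `ρ_* μ₁` has density `h` with respect to `μ₂`, then `(ρ × ρ)_* ν₁` has density
`(x, z) ↦ h z` with respect to `ν₂`. -/
theorem map_ν (hρ : IsIsomorphism R₁ R₂ ρ) {h : X₂ → ℝ≥0∞} (hh : Measurable h)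
    (hμ : R₁.μ.map ρ = R₂.μ.withDensity h) :
    R₁.ν.map (Prod.map ρ ρ) = R₂.ν.withDensity fun p ↦ h p.2 := by
  have hm : Measurable (Prod.map ρ ρ) := ρ.measurable.prodMap ρ.measurable
  by_cases h1 : AEMeasurable R₁.sliceCount R₁.μ
  · have h2 := hρ.aemeasurable_sliceCount h1
    ext E hE
    have hcE : AEMeasurable (fun z ↦ R₂.sliceCount z E) R₂.μ :=
      (measurable_coe hE).comp_aemeasurable h2
    rw [Measure.map_apply hm hE, ν, bind_apply (hm hE) h1, withDensity_apply _ hE,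
      ← lintegral_indicator hE, ν, lintegral_bind h2
        (f := E.indicator fun p : X₂ × X₂ ↦ h p.2)
        ((hh.comp measurable_snd).indicator hE).aemeasurable]
    calc ∫⁻ z, R₁.sliceCount z (Prod.map ρ ρ ⁻¹' E) ∂(R₁.μ)
        = ∫⁻ z, R₂.sliceCount (ρ z) E ∂(R₁.μ) := by
          refine lintegral_congr_ae ?_
          filter_upwards [hρ.ae_map_sliceCount] with z hz
          rw [← hz, Measure.map_apply hm hE]
      _ = ∫⁻ z, R₂.sliceCount z E ∂(R₁.μ.map ρ) := (lintegral_map_equiv (fun z ↦ R₂.sliceCount z E) ρ).symm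
      _ = ∫⁻ z, h z * R₂.sliceCount z E ∂(R₂.μ) := by
          rw [hμ, lintegral_withDensity_eq_lintegral_mul₀ hh.aemeasurable hcE]
          rfl
      _ = _ := by
          refine lintegral_congr fun z ↦ ?_
          -- The measure `sliceCount z` lives on `p.2 = z`, where the density is the constant `h z`.
          have : ∀ᵐ p ∂(R₂.sliceCount z), E.indicator (fun p : X₂ × X₂ ↦ h p.2) p =
              E.indicator (fun _ ↦ h z) p := by
            have hS : MeasurableSet {p : X₂ × X₂ | p.2 ≠ z} :=
              (measurable_snd (measurableSet_singleton z)).compl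
            have := (R₂.sliceCount_apply_eq_zero_iff hS z).2 (by simp)
            filter_upwards [measure_eq_zero_iff_ae_notMem.1 this] with p hp
            simp only [not_not] at hp
            by_cases hpE : p ∈ E <;> simp [hpE, hp]
          rw [lintegral_congr_ae this, lintegral_indicator_const hE]
  · have h2 : ¬ AEMeasurable R₂.sliceCount R₂.μ := fun h2 ↦
      h1 (hρ.symm.aemeasurable_sliceCount h2)
    rw [R₁.ν_eq_zero_of_not_aemeasurable h1, R₂.ν_eq_zero_of_not_aemeasurable h2]
    simp

/-- `ρ_* μ₁` has a density with respect to `μ₂` that is finite and positive everywhere. -/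
theorem exists_density (hρ : IsIsomorphism R₁ R₂ ρ) :
    ∃ h : X₂ → ℝ≥0, Measurable h ∧ (∀ z, 0 < h z) ∧
      R₁.μ.map ρ = R₂.μ.withDensity fun z ↦ (h z : ℝ≥0∞) := by
  have : IsProbabilityMeasure (R₁.μ.map ρ) := isProbabilityMeasure_map ρ.measurable.aemeasurable
  set d := (R₁.μ.map ρ).rnDeriv R₂.μ with hd
  have hdm : Measurable d := measurable_rnDeriv _ _
  classical
  -- The derivative is `0` or `∞` only on a null set; the value `1` there makes the weight
  -- invertible everywhere.
  refine ⟨fun z ↦ if (d z).toNNReal = 0 then 1 else (d z).toNNReal, ?_, fun z ↦ ?_, ?_⟩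
  · exact Measurable.ite (hdm.ennreal_toNNReal (measurableSet_singleton 0)) measurable_const
      hdm.ennreal_toNNReal
  · dsimp only
    split_ifs with h
    · exact one_pos
    · exact pos_iff_ne_zero.2 h
  · conv_lhs => rw [← withDensity_rnDeriv_eq _ _ hρ.map_absolutelyContinuous]
    refine withDensity_congr_ae ?_
    filter_upwards [rnDeriv_lt_top (R₁.μ.map ρ) R₂.μ,
      rnDeriv_pos' hρ.absolutelyContinuous_map] with z h1 h2
    have : (d z).toNNReal ≠ 0 := (ENNReal.toNNReal_pos h2.ne' h1.ne).ne'
    rw [if_neg this, ENNReal.coe_toNNReal h1.ne]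

theorem quasiMeasurePreserving_prodMap (hρ : IsIsomorphism R₁ R₂ ρ) :
    QuasiMeasurePreserving (Prod.map ρ ρ) R₁.ν R₂.ν := by
  obtain ⟨h, hm, -, hh⟩ := hρ.exists_density
  refine ⟨ρ.measurable.prodMap ρ.measurable, ?_⟩
  rw [hρ.map_ν hm.coe_nnreal_ennreal hh]
  exact withDensity_absolutelyContinuous _ _

theorem quasiMeasurePreserving_prodMap_symm (hρ : IsIsomorphism R₁ R₂ ρ) :
    QuasiMeasurePreserving (Prod.map ρ.symm ρ.symm) R₂.ν R₁.ν :=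
  hρ.symm.quasiMeasurePreserving_prodMap

end IsIsomorphism

end FeldmanMooreRelation

/-! ### Functions of the last coordinate and the commutant -/

namespace FeldmanMooreRelation

section RightMultiplication

variable {X : Type*} [MeasurableSpace X] [StandardBorelSpace X] (R : FeldmanMooreRelation X)

/-- Multiplication by a bounded real function of the last coordinate is a bounded self-adjoint
operator on `H`. -/
theorem exists_mulSnd {d : X → ℝ} (hd : Measurable d) {C : ℝ} (hC : ∀ z, |d z| ≤ C) :
    ∃ D : R.H →L[ℂ] R.H, star D = D ∧
      ∀ ξ : R.H, D ξ =ᵐ[R.ν] fun p ↦ (d p.2 : ℂ) * ξ p := by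
  have hdm : Measurable fun p : X × X ↦ (d p.2 : ℂ) :=
    Complex.measurable_ofReal.comp (hd.comp measurable_snd)
  have hL : MemLp (fun p : X × X ↦ (d p.2 : ℂ)) ∞ R.ν :=
    memLp_top_of_bound hdm.aestronglyMeasurable C
      (Eventually.of_forall fun p ↦ by simpa using hC p.2)
  let D : R.H →L[ℂ] R.H :=
    (ContinuousLinearMap.mul ℂ ℂ).holderL R.ν ∞ 2 2 (hL.toLp _)
  have hD : ∀ ξ : R.H, D ξ =ᵐ[R.ν] fun p ↦ (d p.2 : ℂ) * ξ p := fun ξ ↦ by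
    filter_upwards [ContinuousLinearMap.coeFn_holder (r := 2) (ContinuousLinearMap.mul ℂ ℂ)
      (hL.toLp _) ξ, hL.coeFn_toLp] with p h1 h2
    rw [← h2]
    exact h1
  refine ⟨D, ?_, hD⟩
  rw [ContinuousLinearMap.star_eq_adjoint]
  refine ((ContinuousLinearMap.eq_adjoint_iff D D).2 fun ξ η ↦ ?_).symm
  rw [L2.inner_def, L2.inner_def]
  refine integral_congr_ae ?_
  filter_upwards [hD ξ, hD η] with p h1 h2
  rw [h1, h2]
  simp only [RCLike.inner_apply, map_mul, Complex.conj_ofReal]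
  ring

/-- Multiplication by a function of the last coordinate commutes with twisted convolution on
the left, hence with the von Neumann algebra. -/
theorem mulSnd_commute {d : X → ℝ} {D : R.H →L[ℂ] R.H} (hs : star D = D)
    (hD : ∀ ξ : R.H, D ξ =ᵐ[R.ν] fun p ↦ (d p.2 : ℂ) * ξ p)
    {T : R.H →L[ℂ] R.H} (hT : T ∈ R.vonNeumannAlgebra) : D * T = T * D := by
  have key : ∀ S ∈ R.leftFiniteOperators, S * D = D * S := by
    rintro S ⟨a, ha, hS⟩
    ext1 ξ
    refine Lp.ext ?_
    rw [mul_apply_eq_comp, mul_apply_eq_comp]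
    filter_upwards [hS (D ξ), hD (S ξ), hS ξ, R.ae_ν_forall_slice (hD ξ), R.ae_ν_mem_graph]
      with p h1 h2 h3 h4 h5
    rw [h1, h2, h3, conv, conv, ← tsum_mul_left]
    refine tsum_congr fun y ↦ ?_
    -- A nonzero `a (x, y)` forces `x ∼ y`, so `(y, z)` lies in the slice over `z`, where the
    -- formula for `D ξ` is known.
    by_cases hy : a (p.1, y) = 0
    · simp [hy]
    · rw [h4 y (R.r.trans (R.r.symm (ha.2.2.1 hy)) h5)]
      ring
  have hmem : D ∈ StarSubalgebra.centralizer ℂ R.leftFiniteOperators := by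
    refine (StarSubalgebra.mem_centralizer_iff ℂ).2 fun S hS ↦ ⟨key S hS, ?_⟩
    have := congr_arg star (key S hS)
    rw [star_mul, star_mul, hs] at this
    exact this.symm
  exact ((StarSubalgebra.mem_centralizer_iff ℂ).1 hT D hmem).1

/-- If `ζ = d χ_Δ` with `d` a possibly unbounded real function of the last coordinate, then
`T ζ = d s(T)` for all `T` in the von Neumann algebra. -/
theorem apply_mulSnd_chiDiag {d : X → ℝ} (hd : Measurable d) {ζ : R.H}
    (hζ : ζ =ᵐ[R.ν] fun p ↦ (d p.2 : ℂ) * R.chiDiag p)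
    {T : R.H →L[ℂ] R.H} (hT : T ∈ R.vonNeumannAlgebra) :
    T ζ =ᵐ[R.ν] fun p ↦ (d p.2 : ℂ) * T R.chiDiag p := by
  have key : ∀ n : ℕ, ∀ᵐ p ∂(R.ν), |d p.2| ≤ n → T ζ p = (d p.2 : ℂ) * T R.chiDiag p := by
    intro n
    -- Truncate at level `n`: with `P` and `D` multiplication by `1` and by `d` on `|d| ≤ n`, one
    -- has `P ζ = D χ_Δ`. Both commute with `T`, so `P (T ζ) = D (T χ_Δ)`, the claim on `|d| ≤ n`.
    have hB : MeasurableSet {z | |d z| ≤ n} :=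
      measurableSet_le (continuous_abs.measurable.comp hd) measurable_const
    obtain ⟨P, hP, hP'⟩ := R.exists_mulSnd (d := indicator {z | |d z| ≤ n} 1)
      (measurable_one.indicator hB) (C := 1) fun z ↦ by
        by_cases hz : |d z| ≤ n <;> simp [indicator, hz]
    obtain ⟨D, hD, hD'⟩ := R.exists_mulSnd (d := indicator {z | |d z| ≤ n} d)
      (hd.indicator hB) (C := n) fun z ↦ by
        by_cases hz : |d z| ≤ n <;> simp [indicator, hz]
    have h : P ζ = D R.chiDiag := by
      refine Lp.ext ?_
      filter_upwards [hP' ζ, hD' R.chiDiag, hζ] with p h1 h2 h3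
      rw [h1, h2, h3]
      by_cases hz : |d p.2| ≤ n <;> simp [indicator, hz]
    have h' : P (T ζ) = D (T R.chiDiag) := by
      have h1 := DFunLike.congr_fun (R.mulSnd_commute hP hP' hT) ζ
      have h2 := DFunLike.congr_fun (R.mulSnd_commute hD hD' hT) R.chiDiag
      simp only [mul_apply_eq_comp] at h1 h2
      rw [h1, h2, h]
    filter_upwards [hP' (T ζ), hD' (T R.chiDiag)] with p h1 h2 hp
    rw [h', h2] at h1
    simpa [indicator, hp] using h1.symm
  filter_upwards [ae_all_iff.2 key] with p hp
  obtain ⟨n, hn⟩ := exists_nat_ge |d p.2|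
  exact hp n hn

end RightMultiplication

/-! ### The unitary implementing an isomorphism -/

variable {X₁ X₂ : Type*} [MeasurableSpace X₁] [StandardBorelSpace X₁]
  [MeasurableSpace X₂] [StandardBorelSpace X₂]

/-- The unitary `U : L²(R₁, ν₁) → L²(R₂, ν₂)` is of the form `U ξ (x, z) = g z * ξ (ρ⁻¹ x, ρ⁻¹ z)`
with `g` a nowhere vanishing Borel function. -/
structure Implements (R₁ : FeldmanMooreRelation X₁) (R₂ : FeldmanMooreRelation X₂) (ρ : X₁ ≃ᵐ X₂)
    (g : X₂ → ℝ) (U : R₁.H ≃ₗᵢ[ℂ] R₂.H) : Prop where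
  measurable : Measurable g
  ne_zero : ∀ z, g z ≠ 0
  apply_ae_eq : ∀ ξ : R₁.H,
    U ξ =ᵐ[R₂.ν] fun p ↦ (g p.2 : ℂ) * ξ (Prod.map ρ.symm ρ.symm p)

variable {R₁ : FeldmanMooreRelation X₁} {R₂ : FeldmanMooreRelation X₂} {ρ : X₁ ≃ᵐ X₂}

/-- The square of `√h` is the density of `(ρ × ρ)_* ν₁`. Finiteness of the norm is not assumed, so
the identity can also prove that the preimage in the surjectivity argument is in `L²`. -/
theorem IsIsomorphism.eLpNorm_mul_comp (hρ : IsIsomorphism R₁ R₂ ρ) {h : X₂ → ℝ≥0}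
    (hh : Measurable h) (hμ : R₁.μ.map ρ = R₂.μ.withDensity fun z ↦ (h z : ℝ≥0∞))
    {f : X₁ × X₁ → ℂ} (hf : AEStronglyMeasurable f R₁.ν) :
    eLpNorm (fun p ↦ (√(h p.2 : ℝ) : ℂ) * f (Prod.map ρ.symm ρ.symm p)) 2 R₂.ν =
      eLpNorm f 2 R₁.ν := by
  rw [eLpNorm_eq_lintegral_rpow_enorm_toReal (by norm_num) (by norm_num),
    eLpNorm_eq_lintegral_rpow_enorm_toReal (by norm_num) (by norm_num)]
  congr 1
  let θ : X₁ × X₁ ≃ᵐ X₂ × X₂ := ρ.prodCongr ρ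
  have hθ : R₁.ν.map θ = R₂.ν.withDensity fun p ↦ (h p.2 : ℝ≥0∞) :=
    hρ.map_ν (h := fun z ↦ (h z : ℝ≥0∞)) hh.coe_nnreal_ennreal hμ
  have hfc : AEStronglyMeasurable (fun p ↦ f (Prod.map ρ.symm ρ.symm p)) R₂.ν :=
    hf.comp_quasiMeasurePreserving hρ.quasiMeasurePreserving_prodMap_symm
  have hfθ : AEMeasurable (fun p ↦ ‖f (Prod.map ρ.symm ρ.symm p)‖ₑ ^ (2 : ℝ)) R₂.ν :=
    hfc.enorm.pow_const _
  have h1 : ∫⁻ p, ‖f p‖ₑ ^ (2 : ℝ) ∂(R₁.ν) =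
      ∫⁻ p, ‖f (Prod.map ρ.symm ρ.symm p)‖ₑ ^ (2 : ℝ) ∂(R₁.ν.map θ) := by
    have hp : ∀ p, Prod.map ρ.symm ρ.symm (θ p) = p := fun p ↦
      Prod.ext (ρ.symm_apply_apply _) (ρ.symm_apply_apply _)
    rw [lintegral_map_equiv]
    simp only [hp]
  have hm : Measurable fun p : X₂ × X₂ ↦ (h p.2 : ℝ≥0∞) :=
    (hh.comp measurable_snd).coe_nnreal_ennreal
  simp only [ENNReal.toReal_ofNat]
  rw [h1, hθ, lintegral_withDensity_eq_lintegral_mul₀ hm.aemeasurable hfθ]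
  refine lintegral_congr fun p ↦ ?_
  rw [Pi.mul_apply, enorm_mul, ENNReal.mul_rpow_of_nonneg _ _ (by norm_num)]
  congr 1
  rw [← ofReal_norm, Complex.norm_real, Real.norm_of_nonneg (Real.sqrt_nonneg _),
    ENNReal.ofReal_rpow_of_nonneg (Real.sqrt_nonneg _) (by norm_num), Real.rpow_ofNat,
    Real.sq_sqrt (NNReal.coe_nonneg _), ENNReal.ofReal_coe_nnreal]

theorem IsIsomorphism.exists_implements (hρ : IsIsomorphism R₁ R₂ ρ) :
    ∃ g U, Implements R₁ R₂ ρ g U := by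
  obtain ⟨h, hh, hpos, hμ⟩ := hρ.exists_density
  have hgm : Measurable fun z ↦ √(h z : ℝ) := hh.coe_nnreal_real.sqrt
  have hgm' : Measurable fun p : X₂ × X₂ ↦ (√(h p.2 : ℝ) : ℂ) :=
    Complex.measurable_ofReal.comp (hgm.comp measurable_snd)
  have hg0 : ∀ z, √(h z : ℝ) ≠ 0 := fun z ↦
    (Real.sqrt_pos.2 (NNReal.coe_pos.2 (hpos z))).ne'
  have hq := hρ.quasiMeasurePreserving_prodMap_symm
  have hq' := hρ.quasiMeasurePreserving_prodMap
  have hmem : ∀ ξ : R₁.H,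
      MemLp (fun p ↦ (√(h p.2 : ℝ) : ℂ) * ξ (Prod.map ρ.symm ρ.symm p)) 2 R₂.ν := fun ξ ↦
    ⟨hgm'.aestronglyMeasurable.mul ((Lp.aestronglyMeasurable ξ).comp_quasiMeasurePreserving hq),
      by rw [hρ.eLpNorm_mul_comp hh hμ (Lp.aestronglyMeasurable ξ)]; exact Lp.eLpNorm_lt_top ξ⟩
  let V : R₁.H →ₗᵢ[ℂ] R₂.H :=
    { toFun := fun ξ ↦ (hmem ξ).toLp _
      map_add' := fun ξ η ↦ by
        refine Lp.ext ?_
        filter_upwards [(hmem (ξ + η)).coeFn_toLp, (hmem ξ).coeFn_toLp, (hmem η).coeFn_toLp,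
          Lp.coeFn_add ((hmem ξ).toLp _) ((hmem η).toLp _), hq.ae (Lp.coeFn_add ξ η)]
          with p h1 h2 h3 h4 h5
        rw [h1, h4, Pi.add_apply, h2, h3, h5, Pi.add_apply, mul_add]
      map_smul' := fun c ξ ↦ by
        refine Lp.ext ?_
        filter_upwards [(hmem (c • ξ)).coeFn_toLp, (hmem ξ).coeFn_toLp,
          Lp.coeFn_smul c ((hmem ξ).toLp _), hq.ae (Lp.coeFn_smul c ξ)] with p h1 h2 h3 h4
        rw [h1, RingHom.id_apply, h3, Pi.smul_apply, h2, h4, Pi.smul_apply, smul_eq_mul,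
          smul_eq_mul, mul_left_comm]
      norm_map' := fun ξ ↦ by
        change ‖(hmem ξ).toLp _‖ = ‖ξ‖
        rw [Lp.norm_toLp, hρ.eLpNorm_mul_comp hh hμ (Lp.aestronglyMeasurable ξ), Lp.norm_def] }
  have hsurj : Function.Surjective V := fun η ↦ by
    -- The preimage of `η` is `η ∘ (ρ × ρ)` divided by the transported weight.
    have hfm : AEStronglyMeasurable
        (fun p ↦ (√(h (ρ p.2) : ℝ) : ℂ)⁻¹ * η (Prod.map ρ ρ p)) R₁.ν :=
      ((hgm'.comp hq'.measurable).inv.aestronglyMeasurable).mul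
        ((Lp.aestronglyMeasurable η).comp_quasiMeasurePreserving hq')
    have heq : (fun p ↦ (√(h p.2 : ℝ) : ℂ) * ((√(h (ρ (Prod.map ρ.symm ρ.symm p).2) : ℝ) : ℂ)⁻¹ *
        η (Prod.map ρ ρ (Prod.map ρ.symm ρ.symm p)))) = η := by
      funext ⟨x, z⟩
      simp only [Prod.map_apply, ρ.apply_symm_apply]
      rw [mul_inv_cancel_left₀ (Complex.ofReal_ne_zero.2 (hg0 z))]
    have hfL : MemLp (fun p ↦ (√(h (ρ p.2) : ℝ) : ℂ)⁻¹ * η (Prod.map ρ ρ p)) 2 R₁.ν := by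
      refine ⟨hfm, ?_⟩
      rw [← hρ.eLpNorm_mul_comp hh hμ hfm, heq]
      exact Lp.eLpNorm_lt_top η
    refine ⟨hfL.toLp _, Lp.ext ?_⟩
    filter_upwards [(hmem (hfL.toLp _)).coeFn_toLp, hq.ae hfL.coeFn_toLp] with p h1 h2
    refine h1.trans ?_
    rw [h2]
    exact congr_fun heq p
  exact ⟨fun z ↦ √(h z : ℝ), LinearIsometryEquiv.ofSurjective V hsurj, hgm, hg0,
    fun ξ ↦ (hmem ξ).coeFn_toLp⟩

end FeldmanMooreRelation

/-! ### Conjugation of the von Neumann algebras -/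

namespace FeldmanMooreRelation

variable {X₁ X₂ : Type*} [MeasurableSpace X₁] [StandardBorelSpace X₁]
  [MeasurableSpace X₂] [StandardBorelSpace X₂]
  {R₁ : FeldmanMooreRelation X₁} {R₂ : FeldmanMooreRelation X₂} {ρ : X₁ ≃ᵐ X₂}

theorem bandWidth_mono {X : Type*} {E F : Set (X × X)} (h : E ⊆ F) :
    bandWidth E ≤ bandWidth F :=
  iSup₂_mono fun _ _ ↦ add_le_add (encard_le_encard fun _ hz ↦ h hz)
    (encard_le_encard fun _ hz ↦ h hz)

theorem bandWidth_preimage_le {X Y : Type*} (e : Y ≃ X) (E : Set (X × X)) :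
    bandWidth (Prod.map e e ⁻¹' E) ≤ bandWidth E := by
  refine iSup₂_le fun x y ↦ le_trans (add_le_add ?_ ?_) (le_iSup₂
    (f := fun x y ↦ {z | (z, x) ∈ E}.encard + {z | (y, z) ∈ E}.encard) (e x) (e y))
  · exact (encard_preimage_of_bijective e.bijective _).le
  · exact (encard_preimage_of_bijective e.bijective _).le

namespace Implements

variable {g : X₂ → ℝ} {U : R₁.H ≃ₗᵢ[ℂ] R₂.H}

theorem symm_apply_ae_eq (hρ : IsIsomorphism R₁ R₂ ρ) (hU : Implements R₁ R₂ ρ g U) (η : R₂.H) :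
    U.symm η =ᵐ[R₁.ν] fun p ↦ (((g (ρ p.2))⁻¹ : ℝ) : ℂ) * η (Prod.map ρ ρ p) := by
  have h := hU.apply_ae_eq (U.symm η)
  rw [U.apply_symm_apply] at h
  filter_upwards [hρ.quasiMeasurePreserving_prodMap.ae h] with p hp
  have hg : (g (ρ p.2) : ℂ) ≠ 0 := Complex.ofReal_ne_zero.2 (hU.ne_zero _)
  have hpp : Prod.map ρ.symm ρ.symm (Prod.map ρ ρ p) = p :=
    Prod.ext (ρ.symm_apply_apply _) (ρ.symm_apply_apply _)
  rw [hp, hpp, Complex.ofReal_inv]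
  exact (inv_mul_cancel_left₀ hg _).symm

theorem symm (hρ : IsIsomorphism R₁ R₂ ρ) (hU : Implements R₁ R₂ ρ g U) :
    Implements R₂ R₁ ρ.symm (fun z ↦ (g (ρ z))⁻¹) U.symm where
  measurable := (hU.measurable.comp ρ.measurable).inv
  ne_zero _ := inv_ne_zero (hU.ne_zero _)
  apply_ae_eq := hU.symm_apply_ae_eq hρ

end Implements

/-- The transport of a function on `R₁` to a function supported on `R₂`. -/
theorem IsLeftFinite.transport {a : X₁ × X₁ → ℂ} (ha : R₁.IsLeftFinite a) (ρ : X₁ ≃ᵐ X₂)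
    (R₂ : FeldmanMooreRelation X₂) :
    R₂.IsLeftFinite (R₂.graph.indicator (a ∘ Prod.map ρ.symm ρ.symm)) := by
  obtain ⟨hm, ⟨C, hC⟩, -, hb⟩ := ha
  refine ⟨(hm.comp (ρ.symm.measurable.prodMap ρ.symm.measurable)).indicator R₂.measurableSet_rel,
    ⟨C, fun p ↦ (norm_indicator_le_norm_self _ _).trans (hC _)⟩, support_indicator_subset, ?_⟩
  refine lt_of_le_of_lt (bandWidth_mono ?_)
    ((bandWidth_preimage_le ρ.symm.toEquiv (Function.support a)).trans_lt hb)
  rw [support_indicator]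
  exact inter_subset_right

namespace Implements

variable {g : X₂ → ℝ} {U : R₁.H ≃ₗᵢ[ℂ] R₂.H}

/-- `U L₀(a) U⁻¹` is the operator `L₀` of the transport of `a`. -/
theorem conj_mem_leftFiniteOperators (hρ : IsIsomorphism R₁ R₂ ρ) (hU : Implements R₁ R₂ ρ g U)
    {T : R₁.H →L[ℂ] R₁.H} (hT : T ∈ R₁.leftFiniteOperators) :
    U.conjStarAlgEquiv T ∈ R₂.leftFiniteOperators := by
  obtain ⟨a, ha, hT⟩ := hT
  -- The transport of `a` is cut down to `R₂`, because `ρ × ρ` carries `R₁` onto `R₂` only up to a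
  -- null set; for almost every `(x, z)` the cut leaves the row of `x` unchanged.
  refine ⟨_, ha.transport ρ R₂, fun η ↦ ?_⟩
  have hq := hρ.quasiMeasurePreserving_prodMap_symm
  have hq₂ := hρ.quasiMeasurePreserving_symm
  filter_upwards [hU.apply_ae_eq (T (U.symm η)), hq.ae (hT (U.symm η)),
    hq.ae (R₁.ae_ν_forall_slice (hU.symm_apply_ae_eq hρ η)), R₂.ae_ν_mem_graph,
    R₂.ae_ν_of_ae_snd (hq₂.ae hρ.ae_rel_iff), R₂.ae_ν_of_ae_snd (hq₂.ae hρ.ae_cocycle_eq)]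
  rintro ⟨x, z⟩ h1 h2 h3 hxz hrel hσ
  simp only [Prod.map_apply, ρ.apply_symm_apply] at h1 h2 h3 hxz hrel hσ
  rw [LinearIsometryEquiv.conjStarAlgEquiv_apply_apply, h1, h2, conv, conv, ← tsum_mul_left,
    ← ρ.toEquiv.tsum_eq]
  refine tsum_congr fun y ↦ ?_
  have hx : R₁.r (ρ.symm x) (ρ.symm z) := by rw [hrel, ρ.apply_symm_apply]; exact hxz
  have hr : R₂.r x (ρ y) ↔ R₁.r (ρ.symm x) y := by
    constructor
    · intro h
      exact R₁.r.trans hx (R₁.r.symm ((hrel y).2 (R₂.r.trans (R₂.r.symm h) hxz)))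
    · intro h
      exact R₂.r.trans hxz (R₂.r.symm ((hrel y).1 (R₁.r.trans (R₁.r.symm h) hx)))
  simp only [MeasurableEquiv.coe_toEquiv]
  by_cases hxy : R₁.r (ρ.symm x) y
  · have hyz : R₁.r y (ρ.symm z) := R₁.r.trans (R₁.r.symm hxy) hx
    have hmem : (x, ρ y) ∈ R₂.graph := hr.2 hxy
    have hs := hσ (ρ.symm x) y hxy hyz
    rw [ρ.apply_symm_apply] at hs
    rw [indicator_of_mem hmem, h3 y hyz, hs]
    -- All terms of the sum have last coordinate `z`, so the weight of `U` cancels that of `U⁻¹`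
    -- term by term.
    have hg : (g z : ℂ) ≠ 0 := Complex.ofReal_ne_zero.2 (hU.ne_zero _)
    simp only [Function.comp_apply, Prod.map_apply, ρ.symm_apply_apply, Complex.ofReal_inv]
    field_simp
  · have hmem : (x, ρ y) ∉ R₂.graph := fun h ↦ hxy (hr.1 h)
    have h0 : a (ρ.symm x, y) = 0 := by
      by_contra h
      exact hxy (ha.2.2.1 h)
    rw [indicator_of_notMem hmem, h0]
    simp

/-- Conjugation sends the generators of the first algebra into those of the second, so inverse
conjugation sends commutant into commutant, and conjugation sends double commutant into double
commutant. -/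
theorem conj_mem_vonNeumannAlgebra (hρ : IsIsomorphism R₁ R₂ ρ) (hU : Implements R₁ R₂ ρ g U)
    {T : R₁.H →L[ℂ] R₁.H} (hT : T ∈ R₁.vonNeumannAlgebra) :
    U.conjStarAlgEquiv T ∈ R₂.vonNeumannAlgebra := by
  let Φ := U.conjStarAlgEquiv
  change Φ T ∈ R₂.vonNeumannAlgebra
  have key : ∀ S ∈ StarSubalgebra.centralizer ℂ R₂.leftFiniteOperators,
      S * Φ T = Φ T * S := by
    intro S hS
    have hS' : Φ.symm S ∈ StarSubalgebra.centralizer ℂ R₁.leftFiniteOperators := by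
      refine (StarSubalgebra.mem_centralizer_iff ℂ).2 fun A hA ↦ ?_
      have h := (StarSubalgebra.mem_centralizer_iff ℂ).1 hS _
        (hU.conj_mem_leftFiniteOperators hρ hA)
      change Φ A * S = S * Φ A ∧ star (Φ A) * S = S * star (Φ A) at h
      refine ⟨EquivLike.injective Φ ?_, EquivLike.injective Φ ?_⟩
      · rw [map_mul, map_mul, Φ.apply_symm_apply]
        exact h.1
      · rw [map_mul, map_mul, Φ.apply_symm_apply, map_star]
        exact h.2
    have := congr_arg Φ ((StarSubalgebra.mem_centralizer_iff ℂ).1 hT _ hS').1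
    rwa [map_mul, map_mul, Φ.apply_symm_apply] at this
  exact (StarSubalgebra.mem_centralizer_iff ℂ).2 fun S hS ↦ ⟨key S hS, key _ (star_mem hS)⟩

/-- `U⁻¹ χ_Δ = d χ_Δ` with `d = 1 / (g ∘ ρ)`. This factor passes through `T` and is cancelled by the
factor `g` of `U`. -/
theorem symbol_conj (hρ : IsIsomorphism R₁ R₂ ρ) (hU : Implements R₁ R₂ ρ g U)
    (hq : QuasiMeasurePreserving (Prod.map ρ.symm ρ.symm) R₂.ν R₁.ν)
    {T : R₁.H →L[ℂ] R₁.H} (hT : T ∈ R₁.vonNeumannAlgebra) :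
    R₂.symbol (U.conjStarAlgEquiv T) = (R₁.symbol T).compQuasiMeasurePreserving _ hq := by
  have hζ : U.symm R₂.chiDiag =ᵐ[R₁.ν] fun p ↦ (((g (ρ p.2))⁻¹ : ℝ) : ℂ) * R₁.chiDiag p := by
    filter_upwards [hU.symm_apply_ae_eq hρ R₂.chiDiag, R₁.chiDiag_coeFn,
      hρ.quasiMeasurePreserving_prodMap.ae R₂.chiDiag_coeFn] with p h1 h2 h3
    have hd : Prod.map ρ ρ p ∈ diag X₂ ↔ p ∈ diag X₁ := ρ.injective.eq_iff
    rw [h1, h2, h3]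
    by_cases hp : p ∈ diag X₁
    · rw [indicator_of_mem hp, indicator_of_mem (hd.2 hp)]
    · rw [indicator_of_notMem hp, indicator_of_notMem fun h ↦ hp (hd.1 h)]
  have h := R₁.apply_mulSnd_chiDiag (hU.measurable.comp ρ.measurable).inv hζ hT
  refine AEEqFun.ext ?_
  filter_upwards [hU.apply_ae_eq (T (U.symm R₂.chiDiag)), hq.ae h,
    AEEqFun.coeFn_compQuasiMeasurePreserving (R₁.symbol T) hq] with p h1 h2 h3
  rw [h3]
  change U (T (U.symm R₂.chiDiag)) p = (T R₁.chiDiag) (Prod.map ρ.symm ρ.symm p)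
  rw [h1, h2]
  have hg : (g p.2 : ℂ) ≠ 0 := Complex.ofReal_ne_zero.2 (hU.ne_zero _)
  simp [hg]

end Implements

/-! ### Transport of symbols -/

namespace IsIsomorphism

variable (hq : QuasiMeasurePreserving (Prod.map ρ.symm ρ.symm) R₂.ν R₁.ν)

/-- Every operator of the first von Neumann algebra has a counterpart of the same norm in the
second one, whose symbol is the transported symbol. -/
theorem exists_transport (hρ : IsIsomorphism R₁ R₂ ρ) {T : R₁.H →L[ℂ] R₁.H}
    (hT : T ∈ R₁.vonNeumannAlgebra) :
    ∃ S ∈ R₂.vonNeumannAlgebra, ‖S‖ = ‖T‖ ∧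
      R₂.symbol S = (R₁.symbol T).compQuasiMeasurePreserving _ hq := by
  obtain ⟨g, U, hU⟩ := hρ.exists_implements
  exact ⟨_, hU.conj_mem_vonNeumannAlgebra hρ hT,
    NonUnitalStarAlgHom.norm_map U.conjStarAlgEquiv U.conjStarAlgEquiv.injective T,
    hU.symbol_conj hρ hq hT⟩

theorem comp_mem_symbolSet (hρ : IsIsomorphism R₁ R₂ ρ) {a : X₁ × X₁ →ₘ[R₁.ν] ℂ}
    (ha : a ∈ R₁.symbolSet) : a.compQuasiMeasurePreserving _ hq ∈ R₂.symbolSet := by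
  obtain ⟨T, hT, rfl⟩ := ha
  obtain ⟨S, hS, -, hST⟩ := hρ.exists_transport hq hT
  exact ⟨S, hS, hST⟩

theorem comp_comp (hq' : QuasiMeasurePreserving (Prod.map ρ ρ) R₁.ν R₂.ν)
    (a : X₁ × X₁ →ₘ[R₁.ν] ℂ) :
    (a.compQuasiMeasurePreserving _ hq).compQuasiMeasurePreserving _ hq' = a := by
  rw [← AEEqFun.compQuasiMeasurePreserving_comp]
  refine AEEqFun.ext ((AEEqFun.coeFn_compQuasiMeasurePreserving _ _).trans
    (Filter.Eventually.of_forall fun p ↦ congr_arg a ?_))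
  exact Prod.ext (ρ.symm_apply_apply _) (ρ.symm_apply_apply _)

theorem bijOn_symbolSet (hρ : IsIsomorphism R₁ R₂ ρ) :
    BijOn (fun a : X₁ × X₁ →ₘ[R₁.ν] ℂ ↦ a.compQuasiMeasurePreserving _ hq)
      R₁.symbolSet R₂.symbolSet := by
  have hq' := hρ.quasiMeasurePreserving_prodMap
  exact InvOn.bijOn (f' := fun b ↦ b.compQuasiMeasurePreserving _ hq')
    ⟨fun a _ ↦ comp_comp hq hq' a, fun b _ ↦ comp_comp (ρ := ρ.symm) hq' hq b⟩
    (fun _ ha ↦ hρ.comp_mem_symbolSet hq ha) (fun _ hb ↦ comp_mem_symbolSet (ρ := ρ.symm) hq' hρ.symm hb)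

end IsIsomorphism

end FeldmanMooreRelation

/-! ### Composition as an algebra homomorphism -/

namespace MeasureTheory

variable {α β : Type*} [MeasurableSpace α] [MeasurableSpace β] {μ : Measure α} {ν : Measure β}

/-- Composition with a quasi-measure-preserving map as a homomorphism of algebras. -/
noncomputable def AEEqFun.compAlgHom (f : α → β) (hf : QuasiMeasurePreserving f μ ν) :
    (β →ₘ[ν] ℂ) →ₐ[ℂ] (α →ₘ[μ] ℂ) :=
  AlgHom.ofLinearMap
    { toFun := fun a ↦ a.compQuasiMeasurePreserving f hf
      map_add' := fun a b ↦ by induction a, b using AEEqFun.induction_on₂; rfl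
      map_smul' := fun c a ↦ by induction a using AEEqFun.induction_on; rfl }
    rfl (fun a b ↦ by induction a, b using AEEqFun.induction_on₂; rfl)

theorem AEEqFun.comp_mul (f : α → β) (hf : QuasiMeasurePreserving f μ ν) (a b : β →ₘ[ν] ℂ) :
    (a * b).compQuasiMeasurePreserving f hf =
      a.compQuasiMeasurePreserving f hf * b.compQuasiMeasurePreserving f hf :=
  map_mul (AEEqFun.compAlgHom f hf) a b

/-- Essential suprema see only null sets, and every `ν`-null set is null for the pushforward of `μ`.
-/
theorem AEEqFun.eLpNorm_top_comp_le (f : α → β) (hf : QuasiMeasurePreserving f μ ν)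
    (a : β →ₘ[ν] ℂ) : eLpNorm (a.compQuasiMeasurePreserving f hf) ∞ μ ≤ eLpNorm a ∞ ν := by
  rw [eLpNorm_congr_ae (AEEqFun.coeFn_compQuasiMeasurePreserving a hf),
    ← eLpNorm_map_measure (a.aestronglyMeasurable.mono_ac hf.absolutelyContinuous)
      hf.measurable.aemeasurable, eLpNorm_exponent_top, eLpNorm_exponent_top]
  exact eLpNormEssSup_mono_measure _ hf.absolutelyContinuous

end MeasureTheory

/-! ### Transport of Schur multipliers and their norms -/

namespace FeldmanMooreRelation.IsIsomorphism

variable {X₁ X₂ : Type*} [MeasurableSpace X₁] [StandardBorelSpace X₁]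
  [MeasurableSpace X₂] [StandardBorelSpace X₂]
  {R₁ : FeldmanMooreRelation X₁} {R₂ : FeldmanMooreRelation X₂} {ρ : X₁ ≃ᵐ X₂}
  (hq : QuasiMeasurePreserving (Prod.map ρ.symm ρ.symm) R₂.ν R₁.ν)

theorem comp_mem_schurMultipliers (hρ : IsIsomorphism R₁ R₂ ρ) {φ : X₁ × X₁ →ₘ[R₁.ν] ℂ}
    (hφ : φ ∈ R₁.schurMultipliers) :
    φ.compQuasiMeasurePreserving _ hq ∈ R₂.schurMultipliers := by
  refine ⟨Lp.mem_Lp_iff_eLpNorm_lt_top.2 ((AEEqFun.eLpNorm_top_comp_le _ hq φ).trans_lt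
    (Lp.mem_Lp_iff_eLpNorm_lt_top.1 hφ.1)), fun b hb ↦ ?_⟩
  obtain ⟨a, ha, rfl⟩ := (hρ.bijOn_symbolSet hq).surjOn hb
  dsimp only
  rw [← AEEqFun.comp_mul]
  exact hρ.comp_mem_symbolSet hq (hφ.2 a ha)

/-- Each pair `(T, S)` admitted in the supremum for `φ` is transported to an admitted pair with the
same norms. The reverse inequality comes from `ρ⁻¹`. -/
theorem multiplierNorm_le_comp (hρ : IsIsomorphism R₁ R₂ ρ) (φ : X₁ × X₁ →ₘ[R₁.ν] ℂ) :
    R₁.multiplierNorm φ ≤ R₂.multiplierNorm (φ.compQuasiMeasurePreserving _ hq) := by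
  refine iSup₂_le fun T hT ↦ iSup_le fun hT1 ↦ iSup₂_le fun S hS ↦ iSup_le fun hST ↦ ?_
  obtain ⟨T', hT', hTn, hTs⟩ := hρ.exists_transport hq hT
  obtain ⟨S', hS', hSn, hSs⟩ := hρ.exists_transport hq hS
  have hn : ‖S‖ₑ = ‖S'‖ₑ := by rw [← ofReal_norm, ← ofReal_norm, hSn]
  rw [hn, multiplierNorm]
  refine le_iSup₂_of_le T' hT' (le_iSup_of_le (hTn.trans_le hT1)
    (le_iSup₂_of_le S' hS' (le_iSup_of_le ?_ le_rfl)))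
  rw [hSs, hTs, hST, AEEqFun.comp_mul]

/-- Transport of Schur multipliers along an isomorphism. -/
noncomputable def schurMultipliersEquiv (hρ : IsIsomorphism R₁ R₂ ρ) :
    R₁.schurMultipliers ≃ₐ[ℂ] R₂.schurMultipliers :=
  AlgEquiv.ofAlgHom
    (((AEEqFun.compAlgHom _ hq).comp R₁.schurMultipliers.val).codRestrict R₂.schurMultipliers
      fun φ ↦ hρ.comp_mem_schurMultipliers hq φ.2)
    (((AEEqFun.compAlgHom _ hρ.quasiMeasurePreserving_prodMap).comp
      R₂.schurMultipliers.val).codRestrict R₁.schurMultipliers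
      fun φ ↦ comp_mem_schurMultipliers (ρ := ρ.symm)
        hρ.quasiMeasurePreserving_prodMap hρ.symm φ.2)
    (AlgHom.ext fun φ ↦ Subtype.ext <|
      comp_comp (ρ := ρ.symm) hρ.quasiMeasurePreserving_prodMap hq φ.1)
    (AlgHom.ext fun φ ↦ Subtype.ext (comp_comp hq hρ.quasiMeasurePreserving_prodMap φ.1))

end FeldmanMooreRelation.IsIsomorphism

theorem proposition4p11 {X₁ X₂ : Type*} [MeasurableSpace X₁] [StandardBorelSpace X₁]
    [MeasurableSpace X₂] [StandardBorelSpace X₂]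
    (R₁ : FeldmanMooreRelation X₁) (R₂ : FeldmanMooreRelation X₂) (ρ : X₁ ≃ᵐ X₂)
    (hρ : FeldmanMooreRelation.IsIsomorphism R₁ R₂ ρ) :
    -- composition with `ρ⁻² = ρ⁻¹ × ρ⁻¹` is well defined on functions modulo null sets
    ∃ hq : QuasiMeasurePreserving (Prod.map ρ.symm ρ.symm) R₂.ν R₁.ν,
      Set.BijOn (fun a : X₁ × X₁ →ₘ[R₁.ν] ℂ ↦ a.compQuasiMeasurePreserving _ hq)
        R₁.symbolSet R₂.symbolSet ∧
      ∃ e : R₁.schurMultipliers ≃ₐ[ℂ] R₂.schurMultipliers,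
        (∀ φ : R₁.schurMultipliers, (e φ : X₂ × X₂ →ₘ[R₂.ν] ℂ) =
          (φ : X₁ × X₁ →ₘ[R₁.ν] ℂ).compQuasiMeasurePreserving _ hq) ∧
        (∀ φ : R₁.schurMultipliers, eLpNorm (e φ : X₂ × X₂ →ₘ[R₂.ν] ℂ) ∞ R₂.ν =
          eLpNorm (φ : X₁ × X₁ →ₘ[R₁.ν] ℂ) ∞ R₁.ν) ∧
        (∀ φ : R₁.schurMultipliers, R₂.multiplierNorm (e φ) = R₁.multiplierNorm φ) := by
  have hq := hρ.quasiMeasurePreserving_prodMap_symm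
  have hq' := hρ.quasiMeasurePreserving_prodMap
  refine ⟨hq, hρ.bijOn_symbolSet hq, hρ.schurMultipliersEquiv hq, fun _ ↦ rfl, fun φ ↦ ?_,
    fun φ ↦ ?_⟩
  · refine le_antisymm (AEEqFun.eLpNorm_top_comp_le _ hq φ.1) ?_
    conv_lhs => rw [← FeldmanMooreRelation.IsIsomorphism.comp_comp hq hq' φ.1]
    exact AEEqFun.eLpNorm_top_comp_le _ hq' _
  · refine le_antisymm ?_ (hρ.multiplierNorm_le_comp hq φ.1)
    conv_rhs => rw [← FeldmanMooreRelation.IsIsomorphism.comp_comp hq hq' φ.1]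
    exact FeldmanMooreRelation.IsIsomorphism.multiplierNorm_le_comp (ρ := ρ.symm) hq' hρ.symm _
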